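/- **Setting.** There are $K$ arms. An environment $v$ is a vector of mean rewards $(\mu_{v,1},\dots,\mu_{v,K})\in\mathbb R^K$; its set of change points is $\underline{x}^*_v=\{j\in\{1,\dots,K-1\}:\mu_{v,j}\ne\mu_{v,j+1}\}$ and the size of the change at $j\in\underline{x}^*_v$ is $\Delta_{v,j}=|\mu_{v,j}-\mu_{v,j+1}|>0$. For $g\ge1$ let $V^{(g)}_{K,m}$ be the set of environments with exactly $m$ change points in which any two change points $x<y$ satisfy $x+g\le y$. Thus $V^{(2)}_{K,m}=:V_{K,m}$ is the class in which change points are separated by at least one action ($x+1<y$), and $V^{(1)}_{K,m}$ is the class of all environments with $m$ change points. In round $t=1,2,\dots$ a policy $\pi$ plays an arm $a_t$, chosen from the past actions and rewards and possibly internal randomness, and observes $y_t=\mu_{v,a_t}+\epsilon_t$ with $\epsilon_t$ i.i.d. $N(0,\sigma^2)$, where $\sigma>0$ is known. It stops at a stopping time $\tau$ and returns a set $\hat{\underline{x}}_\tau\subseteq\{1,\dots,K-1\}$ of size $N$. For $\delta\in(0,1)$, call $\pi$ an *Any-$(N,\delta)$ policy over $V^{(g)}$* if for every $m\ge N$ and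 every $v\in V^{(g)}_{K,m}$ $$\mathbb P_{\pi,v}(\hat{\underline{x}}_\tau\subseteq\underline{x}^*_v)>1-\delta\quad\text{and}\quad\mathbb P_{\pi,v}(\tau<\infty)=1 .$$ **Theorem.** Let $K\ge3$, $N\ge1$ and $\sigma>0$, and suppose that either (a) $g=1$ and $v\in V_{K,N}=V^{(2)}_{K,N}$; or (b) $g=2$ and $v\in V_{K,N}$ has no two change points at distance exactly $2$, i.e. $v\in V^{(3)}_{K,N}$. (In case (a) policies have to be correct on all environments with at least $N$ change points; in case (b) only on those with separated change points.) Then: 1. For every $\delta\in(0,1)$, every Any-$(N,\delta)$ policy $\pi$ over $V^{(g)}$ with stopping time $\tau$ satisfies $$\mathbb E_{\pi,v}[\tau]\ \ge\ 8\sigma^2\log\Big(\frac1{4\delta}\Big)\sum_{j\in\underline{x}^*_v}\frac1{\Delta_{v,j}^2}.$$ 2. Let $\mathrm{Alt}(v)$ be the set of all $v'\in\bigcup_{m\ge N}V^{(g)}_{K,m}$ with $\underline{x}^*_v\not\subseteq\underline{x}^*_{v'}$, let $D$ denote the Kullback–Leibler divergence, and for $\alpha$ in the simplex $\mathcal P_K$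 put $$F(\alpha)=\inf_{v'\in\mathrm{Alt}(v)}\ \sum_{i=1}^K\alpha_i\,D\big(N(\mu_{v,i},\sigma^2),N(\mu_{v',i},\sigma^2)\big).$$ Then $F$ has a unique maximizer $\alpha^*$ on $\mathcal P_K$. It is given by $$\alpha^*_j=\alpha^*_{j+1}=\frac{1/\Delta_{v,j}^2}{2\sum_{i\in\underline{x}^*_v}1/\Delta_{v,i}^2}\quad\text{for } j\in\underline{x}^*_v,\qquad \alpha^*_i=0\ \text{ for all other arms } i,$$ and $$F(\alpha^*)=\Big(8\sigma^2\sum_{j\in\underline{x}^*_v}\frac1{\Delta_{v,j}^2}\Big)^{-1}.$$ -/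

import Mathlib

open MeasureTheory ProbabilityTheory
open scoped ENNReal NNReal

namespace ChangePointBandit

noncomputable section

/-! ### Environments

There are `K` arms, indexed by `Fin K`. A position `j : Fin (K - 1)` is the gap between the
neighbouring arms `leftArm j` and `rightArm j`. An environment is its vector of mean rewards. -/

/-- The arm just to the left of position `j`. -/
def leftArm {K : ℕ} (j : Fin (K - 1)) : Fin K := ⟨j.1, by have := j.2; omega⟩

/-- The arm just to the right of position `j`. -/
def rightArm {K : ℕ} (j : Fin (K - 1)) : Fin K := ⟨j.1 + 1, by have := j.2; omega⟩

/-- The set of change points of an environment. -/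
def changePoints {K : ℕ} (v : Fin K → ℝ) : Finset (Fin (K - 1)) :=
  Finset.univ.filter fun j => v (leftArm j) ≠ v (rightArm j)

/-- The magnitude of the change in mean at position `j`. -/
def jump {K : ℕ} (v : Fin K → ℝ) (j : Fin (K - 1)) : ℝ := |v (leftArm j) - v (rightArm j)|

/-- `env g K m`: the environments with `K` arms and exactly `m` change points, in which any two
distinct change points are at distance at least `g`.
For `g = 2` the separation condition says `x + 1 < y` for change points `x < y`;
for `g = 1` it is void. -/
def env (g K m : ℕ) : Set (Fin K → ℝ) :=
  {v | (changePoints v).card = m ∧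
    ∀ i ∈ changePoints v, ∀ j ∈ changePoints v, i < j → (i : ℕ) + g ≤ (j : ℕ)}

/-- `∑ 1 / Δ_i ^ 2`, over the change points of `v`. -/
def complexity {K : ℕ} (v : Fin K → ℝ) : ℝ := ∑ j ∈ changePoints v, 1 / jump v j ^ 2

/-! ### Policies and their interaction with an environment -/

/-- The actions and rewards of the first `t` rounds. -/
abbrev History (K t : ℕ) : Type := Fin t → Fin K × ℝ

/-- A (possibly randomized) policy returning sets of `N` positions. The value of the random seed
is drawn at the start and is available to all three rules. -/
structure Policy (K N : ℕ) where
  /-- the space of the internal randomness (one point for a deterministic policy) -/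
  Seed : Type*
  [mSeed : MeasurableSpace Seed]
  /-- the law of the internal randomness -/
  seedLaw : Measure Seed
  [probSeed : IsProbabilityMeasure seedLaw]
  /-- sampling rule: the next action, given the history -/
  sample : (t : ℕ) → Seed × History K t → Fin K
  measurable_sample : ∀ t, Measurable (sample t)
  /-- stopping rule: the histories after which the policy stops -/
  halt : (t : ℕ) → Set (Seed × History K t)
  measurableSet_halt : ∀ t, MeasurableSet (halt t)
  /-- recommendation rule: the estimate returned when halting after `t` rounds -/
  recommend : (t : ℕ) → Seed × History K t → Finset (Fin (K - 1))
  measurableSet_recommend : ∀ t S, MeasurableSet (recommend t ⁻¹' {S})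
  card_recommend : ∀ t h, (recommend t h).card = N

attribute [instance] Policy.mSeed Policy.probSeed

namespace Policy

variable {K N : ℕ}

/-- The sample space: a seed and the noise of each round. -/
abbrev Outcome (π : Policy K N) : Type _ := π.Seed × (ℕ → ℝ)

/-- The probability measure: the seed is independent of the noise, which is i.i.d. Gaussian with
mean `0` and variance `σ ^ 2`. -/
def prob (π : Policy K N) (σ : ℝ≥0) : Measure π.Outcome :=
  π.seedLaw.prod (Measure.infinitePi fun _ : ℕ => gaussianReal 0 (σ ^ 2))

/-- The history of the first `t` rounds when `π` interacts with the environment `v`: in round `t`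
the policy plays the action `a` prescribed by its sampling rule and observes the reward
`v a + (noise of round t)`. -/
def history (π : Policy K N) (v : Fin K → ℝ) (ω : π.Outcome) : (t : ℕ) → History K t
  | 0 => Fin.elim0
  | t + 1 =>
    Fin.snoc (α := fun _ => Fin K × ℝ) (history π v ω t)
      (π.sample t (ω.1, history π v ω t), v (π.sample t (ω.1, history π v ω t)) + ω.2 t)

/-- The policy's stopping rule asks to halt after `t` rounds. -/
def StopsAt (π : Policy K N) (v : Fin K → ℝ) (ω : π.Outcome) (t : ℕ) : Prop :=
  (ω.1, π.history v ω t) ∈ π.halt t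

/-- The stopping time `τ`: the first time at which the stopping rule asks to halt, `⊤` if there is
none. -/
def stoppingTime (π : Policy K N) (v : Fin K → ℝ) (ω : π.Outcome) : ℕ∞ :=
  ⨅ (t : ℕ) (_ : π.StopsAt v ω t), (t : ℕ∞)

/-- The expected stopping time of `π` in the environment `v`. -/
def expectedStoppingTime (π : Policy K N) (σ : ℝ≥0) (v : Fin K → ℝ) : ℝ≥0∞ :=
  ∫⁻ ω, (π.stoppingTime v ω : ℝ≥0∞) ∂(π.prob σ)

/-- The event that `π` stops and its estimate contains only true change points of `v`. -/
def correct (π : Policy K N) (v : Fin K → ℝ) : Set π.Outcome :=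
  {ω | ∃ t : ℕ, π.stoppingTime v ω = (t : ℕ∞) ∧
    π.recommend t (ω.1, π.history v ω t) ⊆ changePoints v}

/-- Any-`(N, δ)` policies, over the environments whose change points are at distance at
least `g`. -/
def IsAny (π : Policy K N) (g : ℕ) (σ : ℝ≥0) (δ : ℝ) : Prop :=
  ∀ m, N ≤ m → ∀ v ∈ env g K m,
    ENNReal.ofReal (1 - δ) < π.prob σ (π.correct v) ∧
    π.prob σ {ω | π.stoppingTime v ω < ⊤} = 1

end Policy

/-! ### Allocations -/

/-- The alternatives to `v`: environments with at least `N` change points that do not have all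
the change points of `v`. -/
def alternatives {K : ℕ} (g N : ℕ) (v : Fin K → ℝ) : Set (Fin K → ℝ) :=
  {v' | (∃ m, N ≤ m ∧ v' ∈ env g K m) ∧ ¬ changePoints v ⊆ changePoints v'}

/-- The information rate of an allocation `α`: the infimum over the alternatives `v'` of
`∑ i, α i * D (v(i), v'(i))`, with `v(i)` the reward distribution of arm `i` and `D` the
Kullback-Leibler divergence. -/
def infoRate {K : ℕ} (g N : ℕ) (σ : ℝ≥0) (v : Fin K → ℝ) (α : Fin K → ℝ) : ℝ≥0∞ :=
  ⨅ v' ∈ alternatives g N v, ∑ i, ENNReal.ofReal (α i) *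
    InformationTheory.klDiv (gaussianReal (v i) (σ ^ 2)) (gaussianReal (v' i) (σ ^ 2))

end

end ChangePointBandit

open ChangePointBandit

open MeasureTheory ProbabilityTheory
open scoped ENNReal NNReal

namespace ChangePointBandit

/-! ### Gaussian measures -/

/-! Fix a change point `j` of `v` and move both means next to it to a common value `m` other than
the two (`mergeAt`). This destroys `j`. The neighbouring positions were not change points, since
those of `v` are at distance at least `g + 1 ≥ 2`, and they become change points, so the number does
not drop. The new change points are at distance 2 from each other and at least `g` from the old
ones; this is why `v` needs `g + 1` while the alternatives only satisfy `g`.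

For the lower bound, take `m` to be the midpoint. As `v` has exactly `N` change points, a correct
answer in `v` contains `j`, hence is wrong in the merged environment. By the Bretagnolle-Huber
inequality the expected log-likelihood ratio between the two must exceed `log (1 / (4 * δ))`. Each
pull next to `j` contributes `Δ ^ 2 / (8 * σ ^ 2)` and other pulls contribute nothing, which bounds
the expected number of pulls next to `j`. Distinct change points have disjoint pairs of arms, so
these bounds add up (`le_tsum_prob_playsNextTo`, `sum_tsum_prob_playsNextTo_le`). Stopping is
handled at a finite horizon: `switchMean` returns to `v` once the policy has halted, so later rounds
carry no information.

For the allocation, every alternative equalizes the two means at some change point, and the cheapest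
way to do so with equal weights is the midpoint. Balancing the costs over change points gives the
value (`infoRate_optimalAllocation`). An allocation attaining it must put the same total mass on
each pair and split it evenly (`infoRate_lt`). -/

lemma gaussianReal_eq_withDensity_gaussianReal (b b' : ℝ) {V : ℝ≥0} (hV : V ≠ 0) :
    gaussianReal b' V = (gaussianReal b V).withDensity
      fun y => ENNReal.ofReal (Real.exp (((y - b) ^ 2 - (y - b') ^ 2) / (2 * V))) := by
  rw [gaussianReal_of_var_ne_zero b' hV, gaussianReal_of_var_ne_zero b hV,
    ← withDensity_mul _ (measurable_gaussianPDF b V) (by fun_prop)]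
  congr 1
  ext y
  simp only [Pi.mul_apply, gaussianPDF_def, gaussianPDFReal_def]
  rw [← ENNReal.ofReal_mul (by positivity), mul_assoc (_)⁻¹, ← Real.exp_add]
  congr 3
  ring

/-- The exponent stays unsimplified so that it matches the increment of `logLikelihood` at the
reward `b + x`. -/
lemma lintegral_gaussianReal_const_add (b b' : ℝ) {V : ℝ≥0} (hV : V ≠ 0) {f : ℝ → ℝ≥0∞}
    (hf : Measurable f) :
    ∫⁻ x, f (b' + x) ∂(gaussianReal 0 V) =
      ∫⁻ x, f (b + x) * ENNReal.ofReal
        (Real.exp (((b + x - b) ^ 2 - (b + x - b') ^ 2) / (2 * V))) ∂(gaussianReal 0 V) := by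
  have key (c : ℝ) (g : ℝ → ℝ≥0∞) (hg : Measurable g) :
      ∫⁻ x, g (c + x) ∂(gaussianReal 0 V) = ∫⁻ y, g y ∂(gaussianReal c V) := by
    rw [← lintegral_map hg (measurable_const_add c), gaussianReal_map_const_add, zero_add]
  rw [key b' f hf, key b (fun y => f y * ENNReal.ofReal
      (Real.exp (((y - b) ^ 2 - (y - b') ^ 2) / (2 * V)))) (by fun_prop),
    gaussianReal_eq_withDensity_gaussianReal b b' hV,
    lintegral_withDensity_eq_lintegral_mul _ (by fun_prop) hf]
  simp [mul_comm]

lemma integrable_id_gaussianReal (b : ℝ) (V : ℝ≥0) :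
    Integrable (fun x : ℝ => x) (gaussianReal b V) :=
  memLp_one_iff_integrable.1 (memLp_id_gaussianReal 1)

/-- With equal variances the log-likelihood ratio is affine, so its expectation only needs the mean
`a`. -/
lemma klDiv_gaussianReal (a b : ℝ) {V : ℝ≥0} (hV : V ≠ 0) :
    InformationTheory.klDiv (gaussianReal a V) (gaussianReal b V) =
      ENNReal.ofReal ((a - b) ^ 2 / (2 * V)) := by
  have hV' : (V : ℝ) ≠ 0 := by exact_mod_cast hV
  have hac : gaussianReal a V ≪ gaussianReal b V := by
    rw [gaussianReal_eq_withDensity_gaussianReal b a hV]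
    exact withDensity_absolutelyContinuous _ _
  have hllr : llr (gaussianReal a V) (gaussianReal b V) =ᵐ[gaussianReal a V]
      fun y => (a - b) / V * y + (b ^ 2 - a ^ 2) / (2 * V) := by
    have h := Measure.rnDeriv_withDensity (gaussianReal b V)
      (f := fun y => ENNReal.ofReal (Real.exp (((y - b) ^ 2 - (y - a) ^ 2) / (2 * V))))
      (by fun_prop)
    rw [← gaussianReal_eq_withDensity_gaussianReal b a hV] at h
    filter_upwards [hac.ae_le h] with y hy
    rw [llr, hy, ENNReal.toReal_ofReal (Real.exp_nonneg _), Real.log_exp]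
    field_simp
    ring
  have hint : Integrable (fun y : ℝ => (a - b) / V * y + (b ^ 2 - a ^ 2) / (2 * V))
      (gaussianReal a V) :=
    ((integrable_id_gaussianReal a V).const_mul _).add (integrable_const _)
  rw [InformationTheory.klDiv_of_ac_of_integrable hac ((integrable_congr hllr).2 hint),
    integral_congr_ae hllr, integral_add ((integrable_id_gaussianReal a V).const_mul _)
      (integrable_const _), integral_const_mul, integral_id_gaussianReal]
  simp only [integral_const, probReal_univ, smul_eq_mul, one_mul, add_sub_cancel_right]
  congr 1
  field_simp
  ring

/-! ### Resampling one coordinate of a product measure -/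

lemma measurePreserving_update_infinitePi {X : Type*} [MeasurableSpace X] (μ : Measure X)
    [IsProbabilityMeasure μ] (n : ℕ) :
    MeasurePreserving (fun p : (ℕ → X) × X => Function.update p.1 n p.2)
      ((Measure.infinitePi fun _ : ℕ => μ).prod μ) (Measure.infinitePi fun _ : ℕ => μ) := by
  have hm : Measurable fun p : (ℕ → X) × X => Function.update p.1 n p.2 := by
    refine measurable_pi_lambda _ fun i => ?_
    by_cases h : i = n
    · subst h; simpa using measurable_snd
    · simp only [Function.update_of_ne h]; fun_prop
  refine ⟨hm, Measure.eq_infinitePi _ fun s t ht => ?_⟩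
  rw [Measure.map_apply hm (MeasurableSet.pi s.countable_toSet fun i _ => ht i)]
  have hpre : (fun p : (ℕ → X) × X => Function.update p.1 n p.2) ⁻¹' (Set.pi s t) =
      Set.pi (s.erase n : Finset ℕ) t ×ˢ (if n ∈ s then t n else Set.univ) := by
    ext ⟨ω, x⟩
    simp only [Set.mem_preimage, Set.mem_pi, Finset.mem_coe, Set.mem_prod, Finset.mem_erase]
    constructor
    · intro h
      refine ⟨fun i hi => ?_, ?_⟩
      · simpa [hi.1] using h i hi.2
      · split_ifs with hn
        · simpa using h n hn
        · trivial
    · rintro ⟨h1, h2⟩ i hi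
      by_cases hin : i = n
      · subst hin; simpa [hi] using h2
      · simpa [hin] using h1 i ⟨hin, hi⟩
  rw [hpre, Measure.prod_prod, Measure.infinitePi_pi _ fun i _ => ht i]
  split_ifs with hn
  · rw [mul_comm, Finset.mul_prod_erase s (fun i => μ (t i)) hn]
  · rw [measure_univ, mul_one, Finset.erase_eq_of_notMem hn]

/-- Redrawing the noise of round `n` leaves the law unchanged. This replaces conditioning on the
past: the history before the draw ignores that coordinate, so Fubini integrates it out. -/
lemma measurePreserving_resample {S X : Type*} [MeasurableSpace S] [MeasurableSpace X]
    (ρ : Measure S) [IsProbabilityMeasure ρ] (μ : Measure X) [IsProbabilityMeasure μ] (n : ℕ) :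
    MeasurePreserving (fun p : (S × (ℕ → X)) × X => (p.1.1, Function.update p.1.2 n p.2))
      ((ρ.prod (Measure.infinitePi fun _ : ℕ => μ)).prod μ)
      (ρ.prod (Measure.infinitePi fun _ : ℕ => μ)) :=
  ((MeasurePreserving.id ρ).prod (measurePreserving_update_infinitePi μ n)).comp
    (measurePreserving_prodAssoc ρ (Measure.infinitePi fun _ : ℕ => μ) μ)

end ChangePointBandit

namespace ChangePointBandit

/-! ### Merging the two arms at a change point -/

section Merge

variable {K : ℕ}

/-- The arms on the two sides of position `j`. -/
def IsNextTo (j : Fin (K - 1)) (i : Fin K) : Prop := i = leftArm j ∨ i = rightArm j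

instance (j : Fin (K - 1)) : DecidablePred (IsNextTo j) :=
  fun i => inferInstanceAs (Decidable (i = leftArm j ∨ i = rightArm j))

/-- The environment `v` with the mean rewards at both sides of position `j` replaced by `m`. -/
def mergeAt (v : Fin K → ℝ) (j : Fin (K - 1)) (m : ℝ) (i : Fin K) : ℝ :=
  if IsNextTo j i then m else v i

lemma isNextTo_iff {j : Fin (K - 1)} {i : Fin K} :
    IsNextTo j i ↔ (i : ℕ) = j ∨ (i : ℕ) = j + 1 := by
  simp [IsNextTo, leftArm, rightArm, Fin.ext_iff]

lemma leftArm_ne_rightArm (j : Fin (K - 1)) : leftArm j ≠ rightArm j := by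
  simp [leftArm, rightArm, Fin.ext_iff]

lemma mem_changePoints {v : Fin K → ℝ} {j : Fin (K - 1)} :
    j ∈ changePoints v ↔ v (leftArm j) ≠ v (rightArm j) := by
  simp [changePoints]

/-- Separation makes the outer neighbours of the merged pair equal in mean to the adjacent arm of
the pair, so `m` differs from them exactly because it differs from both old means. -/
lemma mem_changePoints_mergeAt {g N : ℕ} (hg : 1 ≤ g) {v : Fin K → ℝ} (hv : v ∈ env (g + 1) K N)
    {j : Fin (K - 1)} (hj : j ∈ changePoints v) {m : ℝ} (hl : m ≠ v (leftArm j))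
    (hr : m ≠ v (rightArm j)) (i : Fin (K - 1)) :
    i ∈ changePoints (mergeAt v j m) ↔
      (i ≠ j ∧ i ∈ changePoints v) ∨ (i : ℕ) + 1 = j ∨ (i : ℕ) = j + 1 := by
  have hsep := hv.2
  rcases eq_or_ne i j with rfl | hij
  · simp [mem_changePoints, mergeAt, IsNextTo]
  have hij' : (i : ℕ) ≠ j := fun h => hij (Fin.ext h)
  by_cases h1 : (i : ℕ) + 1 = j
  · have hi : i ∉ changePoints v := fun hi => by
      have := hsep i hi j hj (by rw [Fin.lt_def]; omega)
      omega
    rw [mem_changePoints, not_not] at hi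
    have e : rightArm i = leftArm j := by simp [rightArm, leftArm, h1]
    have hn : ¬ IsNextTo j (leftArm i) := by rw [isNextTo_iff]; simp [leftArm]; omega
    have hn' : IsNextTo j (rightArm i) := Or.inl e
    simp only [mem_changePoints, mergeAt, hn, hn', if_true, if_false, h1, true_or, or_true, iff_true]
    rw [hi, e]
    exact hl.symm
  by_cases h2 : (i : ℕ) = j + 1
  · have hi : i ∉ changePoints v := fun hi => by
      have := hsep j hj i hi (by rw [Fin.lt_def]; omega)
      omega
    rw [mem_changePoints, not_not] at hi
    have e : leftArm i = rightArm j := by simp [rightArm, leftArm, h2]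
    have hn : ¬ IsNextTo j (rightArm i) := by rw [isNextTo_iff]; simp [rightArm]; omega
    have hn' : IsNextTo j (leftArm i) := Or.inr e
    simp only [mem_changePoints, mergeAt, hn, hn', if_true, if_false, h2, or_true, iff_true]
    rw [← hi, e]
    exact hr
  · have hn : ¬ IsNextTo j (rightArm i) := by rw [isNextTo_iff]; simp [rightArm]; omega
    have hn' : ¬ IsNextTo j (leftArm i) := by rw [isNextTo_iff]; simp [leftArm]; omega
    simp [mem_changePoints, mergeAt, hn, hn', h1, h2, hij]

lemma mergeAt_mem_env {g N : ℕ} (hK : 3 ≤ K) (hg : g = 1 ∨ g = 2) {v : Fin K → ℝ}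
    (hv : v ∈ env (g + 1) K N) {j : Fin (K - 1)} (hj : j ∈ changePoints v) {m : ℝ}
    (hl : m ≠ v (leftArm j)) (hr : m ≠ v (rightArm j)) :
    ∃ n, N ≤ n ∧ mergeAt v j m ∈ env g K n := by
  have hmem := mem_changePoints_mergeAt (by omega) hv hj hl hr
  have hsep := hv.2
  refine ⟨_, ?_, rfl, fun a ha b hb hab => ?_⟩
  -- Since `K ≥ 3` there are at least two positions, so `j` has a neighbour `k`; it replaces `j` in
  -- the count.
  · obtain ⟨k, hk⟩ : ∃ k : Fin (K - 1), (k : ℕ) + 1 = j ∨ (k : ℕ) = j + 1 := by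
      have := j.2
      by_cases h0 : (j : ℕ) = 0
      · exact ⟨⟨j + 1, by omega⟩, Or.inr rfl⟩
      · exact ⟨⟨j - 1, by omega⟩, Or.inl (by simp; omega)⟩
    have hkv : k ∉ changePoints v := fun hkv => by
      rcases hk with hk | hk
      · have := hsep k hkv j hj (by rw [Fin.lt_def]; omega)
        omega
      · have := hsep j hj k hkv (by rw [Fin.lt_def]; omega)
        omega
    have hsub : insert k ((changePoints v).erase j) ⊆ changePoints (mergeAt v j m) := by
      intro i hi
      rw [Finset.mem_insert, Finset.mem_erase] at hi
      rw [hmem]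
      rcases hi with rfl | hi
      · exact Or.inr hk
      · exact Or.inl hi
    have hcard := Finset.card_le_card hsub
    rw [Finset.card_insert_of_notMem fun h => hkv (Finset.mem_of_mem_erase h),
      Finset.card_erase_of_mem hj, hv.1] at hcard
    omega
  · rw [hmem] at ha hb
    have hab' : (a : ℕ) < b := hab
    rcases ha with ⟨haj, ha⟩ | ha | ha <;> rcases hb with ⟨hbj, hb⟩ | hb | hb
    · have := hsep a ha b hb hab
      omega
    · have := hsep a ha j hj (by rw [Fin.lt_def]; omega)
      omega
    · have hne : (a : ℕ) ≠ j := fun h => haj (Fin.ext h)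
      have := hsep a ha j hj (by rw [Fin.lt_def]; omega)
      omega
    · have hne : (b : ℕ) ≠ j := fun h => hbj (Fin.ext h)
      have := hsep j hj b hb (by rw [Fin.lt_def]; omega)
      omega
    · omega
    · omega
    · have := hsep j hj b hb (by rw [Fin.lt_def]; omega)
      omega
    · omega
    · omega

lemma notMem_changePoints_mergeAt (v : Fin K → ℝ) (j : Fin (K - 1)) (m : ℝ) :
    j ∉ changePoints (mergeAt v j m) := by
  simp [mem_changePoints, mergeAt, IsNextTo]

lemma mergeAt_mem_alternatives {g N : ℕ} (hK : 3 ≤ K) (hg : g = 1 ∨ g = 2) {v : Fin K → ℝ}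
    (hv : v ∈ env (g + 1) K N) {j : Fin (K - 1)} (hj : j ∈ changePoints v) {m : ℝ}
    (hl : m ≠ v (leftArm j)) (hr : m ≠ v (rightArm j)) :
    mergeAt v j m ∈ alternatives g N v :=
  ⟨mergeAt_mem_env hK hg hv hj hl hr, fun h => notMem_changePoints_mergeAt v j m (h hj)⟩

lemma eq_of_isNextTo {g N : ℕ} (hg : 1 ≤ g) {v : Fin K → ℝ} (hv : v ∈ env (g + 1) K N)
    {j k : Fin (K - 1)} (hj : j ∈ changePoints v) (hk : k ∈ changePoints v) {i : Fin K}
    (hij : IsNextTo j i) (hik : IsNextTo k i) : j = k := by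
  rw [isNextTo_iff] at hij hik
  rcases lt_trichotomy j k with h | h | h
  · have := hv.2 j hj k hk h
    omega
  · exact h
  · have := hv.2 k hk j hj h
    omega

lemma card_filter_isNextTo_le_one {g N : ℕ} (hg : 1 ≤ g) {v : Fin K → ℝ}
    (hv : v ∈ env (g + 1) K N) (i : Fin K) :
    ((changePoints v).filter fun j => IsNextTo j i).card ≤ 1 := by
  rw [Finset.card_le_one]
  intro j hj k hk
  rw [Finset.mem_filter] at hj hk
  exact eq_of_isNextTo hg hv hj.1 hk.1 hj.2 hk.2

lemma sum_isNextTo (j : Fin (K - 1)) (f : Fin K → ℝ) :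
    ∑ i, (if IsNextTo j i then f i else 0) = f (leftArm j) + f (rightArm j) := by
  rw [Finset.sum_eq_add (leftArm j) (rightArm j) (leftArm_ne_rightArm j)]
  · simp [IsNextTo]
  · intro i _ hi
    rw [if_neg]
    rintro (h | h)
    exacts [hi.1 h, hi.2 h]
  · simp
  · simp

/-- The pairs of arms at distinct change points are disjoint. -/
lemma sum_changePoints_le {g N : ℕ} (hg : 1 ≤ g) {v : Fin K → ℝ} (hv : v ∈ env (g + 1) K N)
    {β : Fin K → ℝ} (hβ : ∀ i, 0 ≤ β i) :
    ∑ j ∈ changePoints v, (β (leftArm j) + β (rightArm j)) ≤ ∑ i, β i := by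
  simp_rw [← sum_isNextTo]
  rw [Finset.sum_comm]
  refine Finset.sum_le_sum fun i _ => ?_
  rw [← Finset.sum_filter, Finset.sum_const, nsmul_eq_mul]
  have h : (((changePoints v).filter fun j => IsNextTo j i).card : ℝ) ≤ 1 := by
    exact_mod_cast card_filter_isNextTo_le_one hg hv i
  nlinarith [hβ i]

lemma jump_pos {v : Fin K → ℝ} {j : Fin (K - 1)} (hj : j ∈ changePoints v) : 0 < jump v j :=
  abs_pos.2 (sub_ne_zero.2 (mem_changePoints.1 hj))

lemma jump_sq (v : Fin K → ℝ) (j : Fin (K - 1)) :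
    jump v j ^ 2 = (v (leftArm j) - v (rightArm j)) ^ 2 := sq_abs _

lemma complexity_pos {v : Fin K → ℝ} (h : (changePoints v).Nonempty) : 0 < complexity v :=
  Finset.sum_pos (fun j hj => by have := jump_pos hj; positivity) h

end Merge

/-! ### The optimal allocation -/

section Allocation

variable {K : ℕ}

/-- The information collected under the allocation `α` about the difference between `v` and `w`. -/
noncomputable def information (σ : ℝ≥0) (v w α : Fin K → ℝ) : ℝ :=
  ∑ i, α i * ((v i - w i) ^ 2 / (2 * (σ : ℝ) ^ 2))

lemma infoRate_eq {g N : ℕ} {σ : ℝ≥0} (hσ : 0 < σ) (v : Fin K → ℝ) {α : Fin K → ℝ}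
    (hα : ∀ i, 0 ≤ α i) :
    infoRate g N σ v α = ⨅ w ∈ alternatives g N v, ENNReal.ofReal (information σ v w α) := by
  have hV : σ ^ 2 ≠ 0 := (pow_pos hσ 2).ne'
  unfold infoRate information
  congr! 4 with w hw
  rw [ENNReal.ofReal_sum_of_nonneg fun i _ => mul_nonneg (hα i) (by positivity)]
  refine Finset.sum_congr rfl fun i _ => ?_
  rw [klDiv_gaussianReal _ _ hV, ENNReal.ofReal_mul (hα i)]
  simp

lemma information_mergeAt (σ : ℝ≥0) (v α : Fin K → ℝ) (j : Fin (K - 1)) (m : ℝ) :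
    information σ v (mergeAt v j m) α =
      (α (leftArm j) * (v (leftArm j) - m) ^ 2 + α (rightArm j) * (v (rightArm j) - m) ^ 2) /
        (2 * (σ : ℝ) ^ 2) := by
  have h : information σ v (mergeAt v j m) α =
      ∑ i, if IsNextTo j i then α i * ((v i - m) ^ 2 / (2 * (σ : ℝ) ^ 2)) else 0 := by
    refine Finset.sum_congr rfl fun i _ => ?_
    by_cases hi : IsNextTo j i <;> simp [mergeAt, hi]
  rw [h, sum_isNextTo]
  ring

lemma le_information {σ : ℝ≥0} {v w α : Fin K → ℝ} (hα : ∀ i, 0 ≤ α i) {j : Fin (K - 1)}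
    (hw : w (leftArm j) = w (rightArm j)) :
    (α (leftArm j) * (v (leftArm j) - w (leftArm j)) ^ 2 +
      α (rightArm j) * (v (rightArm j) - w (leftArm j)) ^ 2) / (2 * (σ : ℝ) ^ 2) ≤
      information σ v w α := by
  have h := sum_isNextTo j fun i => α i * ((v i - w i) ^ 2 / (2 * (σ : ℝ) ^ 2))
  rw [← hw] at h
  calc _ = ∑ i, if IsNextTo j i then α i * ((v i - w i) ^ 2 / (2 * (σ : ℝ) ^ 2)) else 0 := by
        rw [h]; ring
    _ ≤ _ := Finset.sum_le_sum fun i _ => by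
        have := mul_nonneg (hα i) (by positivity : 0 ≤ (v i - w i) ^ 2 / (2 * (σ : ℝ) ^ 2))
        split_ifs <;> simp [this]

/-- The mass that the optimal allocation gives to either side of the change point `j`. -/
noncomputable def optimalMass (v : Fin K → ℝ) (j : Fin (K - 1)) : ℝ :=
  (1 / jump v j ^ 2) / (2 * complexity v)

/-- The optimal allocation. -/
noncomputable def optimalAllocation (v : Fin K → ℝ) (i : Fin K) : ℝ :=
  ∑ j ∈ changePoints v, if IsNextTo j i then optimalMass v j else 0

lemma optimalMass_pos {v : Fin K → ℝ} {j : Fin (K - 1)} (hj : j ∈ changePoints v) :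
    0 < optimalMass v j := by
  have := jump_pos hj
  have := complexity_pos ⟨j, hj⟩
  unfold optimalMass
  positivity

lemma sum_optimalMass {v : Fin K → ℝ} (h : (changePoints v).Nonempty) :
    ∑ j ∈ changePoints v, 2 * optimalMass v j = 1 := by
  have hC := complexity_pos h
  have e (j : Fin (K - 1)) : 2 * optimalMass v j = 1 / jump v j ^ 2 / complexity v := by
    unfold optimalMass
    field_simp
  simp_rw [e]
  rw [← Finset.sum_div]
  exact div_self hC.ne'

lemma optimalAllocation_nonneg (v : Fin K → ℝ) (i : Fin K) : 0 ≤ optimalAllocation v i :=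
  Finset.sum_nonneg fun j hj => by
    split_ifs
    exacts [(optimalMass_pos hj).le, le_rfl]

lemma sum_optimalAllocation {v : Fin K → ℝ} (h : (changePoints v).Nonempty) :
    ∑ i, optimalAllocation v i = 1 := by
  unfold optimalAllocation
  rw [Finset.sum_comm, ← sum_optimalMass h]
  refine Finset.sum_congr rfl fun j _ => ?_
  rw [sum_isNextTo j fun _ => optimalMass v j]
  ring

lemma optimalAllocation_of_isNextTo {g N : ℕ} (hg : 1 ≤ g) {v : Fin K → ℝ}
    (hv : v ∈ env (g + 1) K N) {j : Fin (K - 1)} (hj : j ∈ changePoints v) {i : Fin K}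
    (hi : IsNextTo j i) : optimalAllocation v i = optimalMass v j := by
  unfold optimalAllocation
  rw [Finset.sum_eq_single_of_mem j hj, if_pos hi]
  intro k hk hkj
  rw [if_neg fun h => hkj (eq_of_isNextTo hg hv hk hj h hi)]

lemma optimalAllocation_eq_zero {v : Fin K → ℝ} {i : Fin K}
    (h : ∀ j ∈ changePoints v, ¬ IsNextTo j i) : optimalAllocation v i = 0 :=
  Finset.sum_eq_zero fun j hj => if_neg (h j hj)

lemma midpoint_ne {a b : ℝ} (h : a ≠ b) : (a + b) / 2 ≠ a ∧ (a + b) / 2 ≠ b :=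
  ⟨fun e => h (by linarith), fun e => h (by linarith)⟩

lemma infoRate_optimalAllocation {g N : ℕ} (hK : 3 ≤ K) (hN : 1 ≤ N) (hg : g = 1 ∨ g = 2)
    {σ : ℝ≥0} (hσ : 0 < σ) {v : Fin K → ℝ} (hv : v ∈ env (g + 1) K N) :
    infoRate g N σ v (optimalAllocation v) =
      ENNReal.ofReal (1 / (8 * (σ : ℝ) ^ 2 * complexity v)) := by
  have hg1 : 1 ≤ g := by omega
  have hne : (changePoints v).Nonempty := Finset.card_pos.1 (by rw [hv.1]; omega)
  have hC := complexity_pos hne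
  have hσ' : (0 : ℝ) < σ := hσ
  have hmass {j} (hj : j ∈ changePoints v) :
      optimalMass v j * (v (leftArm j) - v (rightArm j)) ^ 2 = 1 / (2 * complexity v) := by
    have := jump_pos hj
    rw [← jump_sq, optimalMass]
    field_simp
  have hL {j} (hj : j ∈ changePoints v) := optimalAllocation_of_isNextTo hg1 hv hj (Or.inl rfl)
  have hR {j} (hj : j ∈ changePoints v) := optimalAllocation_of_isNextTo hg1 hv hj (Or.inr rfl)
  have hval : 1 / (8 * (σ : ℝ) ^ 2 * complexity v) =
      1 / (2 * complexity v) / 2 / (2 * (σ : ℝ) ^ 2) := by field_simp; norm_num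
  rw [infoRate_eq hσ v (optimalAllocation_nonneg v)]
  apply le_antisymm
  · obtain ⟨j, hj⟩ := hne
    have hm := midpoint_ne (mem_changePoints.1 hj)
    refine (iInf₂_le _ (mergeAt_mem_alternatives hK hg hv hj hm.1 hm.2)).trans
      (ENNReal.ofReal_le_ofReal ?_)
    rw [information_mergeAt, hL hj, hR hj, hval, ← hmass hj]
    apply le_of_eq
    ring
  · refine le_iInf₂ fun w hw => ENNReal.ofReal_le_ofReal ?_
    obtain ⟨j, hj, hjw⟩ := Finset.not_subset.1 hw.2
    rw [mem_changePoints, not_not] at hjw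
    refine le_trans ?_ (le_information (optimalAllocation_nonneg v) hjw)
    rw [hL hj, hR hj, hval, ← hmass hj]
    gcongr
    -- With `x`, `y` the deviations of the two means from the common value, `x ^ 2 + y ^ 2 - (x - y)
    -- ^ 2 / 2 = (x + y) ^ 2 / 2`.
    nlinarith [optimalMass_pos hj, mul_nonneg (optimalMass_pos hj).le
      (sq_nonneg (v (leftArm j) - w (leftArm j) + (v (rightArm j) - w (leftArm j))))]

/-- Two weights are equal if the midpoint minimizes the weighted sum of squared distances to the
two ends of a nondegenerate interval. -/
lemma eq_of_midpoint_minimizes {a b p q : ℝ} (hab : a ≠ b) (hp : 0 ≤ p) (hq : 0 ≤ q)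
    (h : ∀ m, m ≠ a → m ≠ b →
      (p + q) * (a - b) ^ 2 / 4 ≤ p * (a - m) ^ 2 + q * (b - m) ^ 2) : p = q := by
  rcases (add_nonneg hp hq).eq_or_lt with hs | hs
  · linarith
  by_contra hpq
  have hd : a - b ≠ 0 := sub_ne_zero.2 hab
  -- This `r` goes half of the way from the midpoint to the weighted mean, the true minimizer. The
  -- weighted mean itself may be an excluded endpoint (when a weight vanishes), whereas half of the
  -- way stays strictly inside.
  obtain ⟨r, hr⟩ : ∃ r, r * (4 * (p + q)) = p - q := ⟨(p - q) / (4 * (p + q)), by field_simp⟩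
  have hr1 : |r| < 1 / 2 := by
    rw [abs_lt]
    constructor <;> nlinarith
  have hr0 : r ≠ 0 := fun h0 => hpq (by rw [h0] at hr; linarith)
  rw [abs_lt] at hr1
  have hm := h ((a + b) / 2 + r * (a - b))
    (fun e => by
      have : (r - 1 / 2) * (a - b) = 0 := by linear_combination e
      rcases mul_eq_zero.1 this with h | h
      · linarith
      · exact hd h)
    (fun e => by
      have : (r + 1 / 2) * (a - b) = 0 := by linear_combination e
      rcases mul_eq_zero.1 this with h | h
      · linarith
      · exact hd h)
  have e : p * (a - ((a + b) / 2 + r * (a - b))) ^ 2 + q * (b - ((a + b) / 2 + r * (a - b))) ^ 2 =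
      (p + q) * (a - b) ^ 2 / 4 - 3 * ((p + q) * r ^ 2 * (a - b) ^ 2) := by
    have : p = q + r * (4 * (p + q)) := by linarith
    linear_combination (-(a - b) ^ 2 * r) * hr.symm
  have : 0 < (p + q) * r ^ 2 * (a - b) ^ 2 := by positivity
  linarith

/-- Midpoint alternatives force at least the optimal mass on each pair. These masses already sum to
1, so every pair has equality; moving `m` off the midpoint then forces an even split. -/
lemma infoRate_lt {g N : ℕ} (hK : 3 ≤ K) (hN : 1 ≤ N) (hg : g = 1 ∨ g = 2)
    {σ : ℝ≥0} (hσ : 0 < σ) {v : Fin K → ℝ} (hv : v ∈ env (g + 1) K N) {β : Fin K → ℝ}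
    (hβ : β ∈ stdSimplex ℝ (Fin K)) (hne : β ≠ optimalAllocation v) :
    infoRate g N σ v β < ENNReal.ofReal (1 / (8 * (σ : ℝ) ^ 2 * complexity v)) := by
  have hg1 : 1 ≤ g := by omega
  have hcp : (changePoints v).Nonempty := Finset.card_pos.1 (by rw [hv.1]; omega)
  have hC := complexity_pos hcp
  have hσ' : (0 : ℝ) < σ := hσ
  by_contra! hle
  apply hne
  rw [infoRate_eq hσ v hβ.1] at hle
  have hm {j} (hj : j ∈ changePoints v) {m : ℝ} (hl : m ≠ v (leftArm j))
      (hr : m ≠ v (rightArm j)) : 1 / (4 * complexity v) ≤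
      β (leftArm j) * (v (leftArm j) - m) ^ 2 + β (rightArm j) * (v (rightArm j) - m) ^ 2 := by
    have h1 := hle.trans (iInf₂_le _ (mergeAt_mem_alternatives hK hg hv hj hl hr))
    have hnn : 0 ≤ information σ v (mergeAt v j m) β :=
      Finset.sum_nonneg fun i _ => mul_nonneg (hβ.1 i) (by positivity)
    rw [ENNReal.ofReal_le_ofReal_iff hnn, information_mergeAt, le_div_iff₀ (by positivity)] at h1
    refine le_of_eq_of_le ?_ h1
    field_simp
    norm_num
  have hmass {j} (hj : j ∈ changePoints v) :
      1 / (4 * complexity v) = 2 * optimalMass v j * jump v j ^ 2 / 4 := by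
    have := jump_pos hj
    rw [optimalMass]
    field_simp
  have hge : ∀ j ∈ changePoints v, 2 * optimalMass v j ≤ β (leftArm j) + β (rightArm j) := by
    intro j hj
    have hmid := midpoint_ne (mem_changePoints.1 hj)
    have h1 := hm hj hmid.1 hmid.2
    rw [hmass hj] at h1
    have hJ := jump_pos hj
    refine le_of_mul_le_mul_right ?_ (by positivity : 0 < jump v j ^ 2 / 4)
    refine le_of_eq_of_le (by ring) (h1.trans (le_of_eq ?_))
    rw [jump_sq]
    ring
  have hsum : ∑ j ∈ changePoints v, 2 * optimalMass v j =
      ∑ j ∈ changePoints v, (β (leftArm j) + β (rightArm j)) := by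
    refine le_antisymm (Finset.sum_le_sum hge) ?_
    rw [sum_optimalMass hcp, ← hβ.2]
    exact sum_changePoints_le hg1 hv hβ.1
  have heq := (Finset.sum_eq_sum_iff_of_le hge).1 hsum
  have hsides : ∀ j ∈ changePoints v, β (leftArm j) = β (rightArm j) := by
    intro j hj
    refine eq_of_midpoint_minimizes (mem_changePoints.1 hj) (hβ.1 _) (hβ.1 _) fun m hl hr => ?_
    rw [← heq j hj, ← jump_sq, ← hmass hj]
    exact hm hj hl hr
  have hpt : ∀ i ∈ Finset.univ, optimalAllocation v i ≤ β i := by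
    intro i _
    by_cases h : ∃ j ∈ changePoints v, IsNextTo j i
    · obtain ⟨j, hj, hi⟩ := h
      rw [optimalAllocation_of_isNextTo hg1 hv hj hi]
      have h1 := heq j hj
      have h2 := hsides j hj
      rcases hi with rfl | rfl <;> linarith
    · push Not at h
      rw [optimalAllocation_eq_zero h]
      exact hβ.1 i
  have h1 := (Finset.sum_eq_sum_iff_of_le hpt).1 ((sum_optimalAllocation hcp).trans hβ.2.symm)
  exact funext fun i => (h1 i (Finset.mem_univ i)).symm

end Allocation

end ChangePointBandit

namespace ChangePointBandit

/-! ### The Bretagnolle-Huber inequality -/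

/-- The tangent of `exp` at `c / 2` stands in for Jensen, and AM-GM with weight `l` for
Cauchy-Schwarz, using that `exp x` is the product of its minimum and maximum with 1. -/
lemma two_mul_exp_half_le {x c l : ℝ} (hl : 0 < l) :
    2 * (Real.exp (c / 2) * (1 + (x - c) / 2)) ≤
      l * min (Real.exp x) 1 + (1 + Real.exp x) / l := by
  have h1 : Real.exp (c / 2) * (1 + (x - c) / 2) ≤ Real.exp (x / 2) := by
    have h := Real.add_one_le_exp ((x - c) / 2)
    calc _ ≤ Real.exp (c / 2) * Real.exp ((x - c) / 2) := by gcongr; linarith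
      _ = Real.exp (x / 2) := by rw [← Real.exp_add]; congr 1; ring
  set s := Real.exp (x / 2) with hs
  have hs0 : 0 < s := Real.exp_pos _
  have hx : Real.exp x = s * s := by rw [hs, ← Real.exp_add]; congr 1; ring
  refine (mul_le_mul_of_nonneg_left h1 zero_le_two).trans ?_
  rw [hx, ← sub_nonneg]
  have e (y : ℝ) : l * y + (1 + s * s) / l - 2 * s = (l ^ 2 * y + 1 + s * s - 2 * s * l) / l := by
    field_simp
    ring
  rw [e]
  refine div_nonneg ?_ hl.le
  rcases min_cases (s * s) 1 with ⟨h, -⟩ | ⟨h, -⟩ <;> rw [h]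
  · nlinarith [sq_nonneg (l * s - 1), mul_pos hs0 hs0]
  · nlinarith [sq_nonneg (l - s)]

/-- `exp X` is the density of a second law `Q`, so `∫ X` is minus the divergence of `P` from `Q`,
and the right side is `Q A + P Aᶜ`. -/
lemma bretagnolle_huber {Ω : Type*} [MeasurableSpace Ω] {P : Measure Ω} [IsProbabilityMeasure P]
    {X : Ω → ℝ} (hX : Measurable X) (hXi : Integrable X P)
    (hexp : ∫⁻ ω, ENNReal.ofReal (Real.exp (X ω)) ∂P = 1) {A : Set Ω} (hA : MeasurableSet A) :
    ENNReal.ofReal (Real.exp (∫ ω, X ω ∂P) / 2) ≤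
      ∫⁻ ω in A, ENNReal.ofReal (Real.exp (X ω)) ∂P + P Aᶜ := by
  set c := ∫ ω, X ω ∂P with hc
  have hEm : Measurable fun ω => Real.exp (X ω) := by fun_prop
  have hEi : Integrable (fun ω => Real.exp (X ω)) P := by
    refine ⟨hEm.aestronglyMeasurable, ?_⟩
    rw [hasFiniteIntegral_iff_ofReal (ae_of_all _ fun _ => (Real.exp_pos _).le), hexp]
    exact ENNReal.one_lt_top
  have hE1 : ∫ ω, Real.exp (X ω) ∂P = 1 := by
    rw [integral_eq_lintegral_of_nonneg_ae (ae_of_all _ fun _ => (Real.exp_pos _).le)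
      hEm.aestronglyMeasurable, hexp, ENNReal.toReal_one]
  have hmi : Integrable (fun ω => min (Real.exp (X ω)) 1) P := hEi.inf (integrable_const 1)
  have hXc : Integrable (fun ω => (X ω - c) / 2) P := (hXi.sub (integrable_const c)).div_const 2
  have hEl (l : ℝ) : Integrable (fun ω => (1 + Real.exp (X ω)) / l) P :=
    ((integrable_const 1).add hEi).div_const l
  have hmin : Real.exp c / 2 ≤ ∫ ω, min (Real.exp (X ω)) 1 ∂P := by
    -- This weight optimizes the bound `2 * exp (c / 2) ≤ l * E[min] + 2 / l` on the expected
    -- minimum.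
    set l := 2 * Real.exp (-c / 2) with hl
    have hl0 : 0 < l := by positivity
    have hI : ∫ ω, 2 * (Real.exp (c / 2) * (1 + (X ω - c) / 2)) ∂P ≤
        ∫ ω, l * min (Real.exp (X ω)) 1 + (1 + Real.exp (X ω)) / l ∂P := by
      refine integral_mono ?_ ?_ fun ω => two_mul_exp_half_le hl0
      · exact (((integrable_const 1).add hXc).const_mul _).const_mul _
      · exact (hmi.const_mul l).add (hEl l)
    rw [integral_const_mul, integral_const_mul,
      integral_add (integrable_const 1) hXc,
      integral_div, integral_sub hXi (integrable_const c),
      integral_add (hmi.const_mul l) (hEl l),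
      integral_const_mul, integral_div, integral_add (integrable_const 1) hEi, hE1, ← hc] at hI
    simp only [integral_const, probReal_univ, one_smul, sub_self, zero_div, add_zero, mul_one] at hI
    set e := Real.exp (c / 2) with he
    have he0 : 0 < e := Real.exp_pos _
    have hle : l = 2 / e := by
      rw [hl, he, neg_div, Real.exp_neg]
      field_simp
    have hee : Real.exp c = e * e := by rw [he, ← Real.exp_add]; congr 1; ring
    rw [hle] at hI
    field_simp at hI
    rw [hee]
    nlinarith
  calc ENNReal.ofReal (Real.exp c / 2)
      ≤ ENNReal.ofReal (∫ ω, min (Real.exp (X ω)) 1 ∂P) := ENNReal.ofReal_le_ofReal hmin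
    _ = ∫⁻ ω, ENNReal.ofReal (min (Real.exp (X ω)) 1) ∂P :=
        ofReal_integral_eq_lintegral_ofReal hmi
          (ae_of_all _ fun _ => le_min (Real.exp_pos _).le zero_le_one)
    _ = ∫⁻ ω in A, ENNReal.ofReal (min (Real.exp (X ω)) 1) ∂P +
          ∫⁻ ω in Aᶜ, ENNReal.ofReal (min (Real.exp (X ω)) 1) ∂P := (lintegral_add_compl _ hA).symm
    _ ≤ ∫⁻ ω in A, ENNReal.ofReal (Real.exp (X ω)) ∂P + ∫⁻ _ in Aᶜ, 1 ∂P := by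
        gcongr with ω ω
        · exact min_le_left _ _
        · exact (ENNReal.ofReal_le_ofReal (min_le_right _ _)).trans (by simp)
    _ = _ := by simp

/-! ### Interaction with adaptive mean rewards -/

lemma measurable_snoc {X α : Type*} [MeasurableSpace X] [MeasurableSpace α] {n : ℕ}
    {f : X → Fin n → α} {g : X → α} (hf : Measurable f) (hg : Measurable g) :
    Measurable fun x => (Fin.snoc (f x) (g x) : Fin (n + 1) → α) := by
  refine measurable_pi_lambda _ fun i => ?_
  refine Fin.lastCases ?_ (fun i => ?_) i
  · simpa using hg
  · simpa using measurable_pi_iff.1 hf i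

lemma measurable_init {α : Type*} [MeasurableSpace α] (n : ℕ) :
    Measurable fun h : Fin (n + 1) → α => (Fin.init h : Fin n → α) :=
  measurable_pi_lambda _ fun i => measurable_pi_apply i.castSucc

namespace Policy

variable {K N : ℕ} (π : Policy K N)

/-- Mean rewards that may depend on the seed and the history. -/
abbrev AdaptiveMean : Type _ := (t : ℕ) → π.Seed × History K t → ℝ

/-- The history of the first `t` rounds when the mean rewards are adaptive. -/
def adaptiveHistory (b : π.AdaptiveMean) (ω : π.Outcome) : (t : ℕ) → History K t
  | 0 => Fin.elim0
  | t + 1 =>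
    Fin.snoc (α := fun _ => Fin K × ℝ) (adaptiveHistory b ω t)
      (π.sample t (ω.1, adaptiveHistory b ω t), b t (ω.1, adaptiveHistory b ω t) + ω.2 t)

/-- The adaptive mean rewards that come from an environment. -/
def envMean (v : Fin K → ℝ) : π.AdaptiveMean := fun t p => v (π.sample t p)

lemma adaptiveHistory_envMean (v : Fin K → ℝ) (ω : π.Outcome) (t : ℕ) :
    π.adaptiveHistory (π.envMean v) ω t = π.history v ω t := by
  induction t with
  | zero => rfl
  | succ t ih => simp only [adaptiveHistory, history, ih, envMean]

lemma measurable_envMean (v : Fin K → ℝ) (t : ℕ) : Measurable (π.envMean v t) :=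
  (measurable_of_finite v).comp (π.measurable_sample t)

variable {π} {b b' : π.AdaptiveMean}

lemma measurable_adaptiveHistory (hb : ∀ t, Measurable (b t)) (t : ℕ) :
    Measurable fun ω : π.Outcome => π.adaptiveHistory b ω t := by
  induction t with
  | zero => exact measurable_pi_lambda _ fun i => i.elim0
  | succ t ih =>
    have h : Measurable fun ω : π.Outcome => (ω.1, π.adaptiveHistory b ω t) :=
      measurable_fst.prodMk ih
    exact measurable_snoc ih (((π.measurable_sample t).comp h).prodMk
      (((hb t).comp h).add ((measurable_pi_apply t).comp measurable_snd)))

lemma measurable_seed_history (hb : ∀ t, Measurable (b t)) (t : ℕ) :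
    Measurable fun ω : π.Outcome => (ω.1, π.adaptiveHistory b ω t) :=
  measurable_fst.prodMk (measurable_adaptiveHistory hb t)

lemma adaptiveHistory_update (s : π.Seed) (ω : ℕ → ℝ) (n : ℕ) (x : ℝ) {t : ℕ} (ht : t ≤ n) :
    π.adaptiveHistory b (s, Function.update ω n x) t = π.adaptiveHistory b (s, ω) t := by
  induction t with
  | zero => rfl
  | succ t ih =>
    simp only [adaptiveHistory, ih (by omega), Function.update_of_ne (by omega : t ≠ n)]

instance (σ : ℝ≥0) : IsProbabilityMeasure (π.prob σ) := by
  unfold prob; infer_instance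

lemma measurePreserving_resample_prob (π : Policy K N) (σ : ℝ≥0) (n : ℕ) :
    MeasurePreserving (fun p : π.Outcome × ℝ => (p.1.1, Function.update p.1.2 n p.2))
      ((π.prob σ).prod (gaussianReal 0 (σ ^ 2))) (π.prob σ) :=
  measurePreserving_resample _ _ n

lemma lintegral_adaptiveHistory_succ (σ : ℝ≥0) (hb : ∀ t, Measurable (b t)) (n : ℕ)
    {F : π.Seed × History K (n + 1) → ℝ≥0∞} (hF : Measurable F) :
    ∫⁻ ω, F (ω.1, π.adaptiveHistory b ω (n + 1)) ∂(π.prob σ) =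
      ∫⁻ ω, ∫⁻ x, F (ω.1, Fin.snoc (α := fun _ => Fin K × ℝ) (π.adaptiveHistory b ω n)
        (π.sample n (ω.1, π.adaptiveHistory b ω n), b n (ω.1, π.adaptiveHistory b ω n) + x))
        ∂(gaussianReal 0 (σ ^ 2)) ∂(π.prob σ) := by
  have hm : Measurable fun ω : π.Outcome => F (ω.1, π.adaptiveHistory b ω (n + 1)) :=
    hF.comp (measurable_seed_history hb (n + 1))
  have hmp := measurePreserving_resample_prob π σ n
  rw [← hmp.lintegral_comp hm]
  refine (lintegral_prod _ (hm.comp hmp.measurable).aemeasurable).trans ?_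
  simp only [Function.comp_apply, adaptiveHistory, adaptiveHistory_update _ _ n _ le_rfl,
    Function.update_self]

/-- The logarithm of the likelihood ratio of `b'` with respect to `b`, for Gaussian rewards of
variance `V`. -/
noncomputable def logLikelihood (b b' : π.AdaptiveMean) (V : ℝ) : (t : ℕ) → π.Seed × History K t → ℝ
  | 0, _ => 0
  | t + 1, p => logLikelihood b b' V t (p.1, Fin.init p.2) +
      (((p.2 (Fin.last t)).2 - b t (p.1, Fin.init p.2)) ^ 2 -
        ((p.2 (Fin.last t)).2 - b' t (p.1, Fin.init p.2)) ^ 2) / (2 * V)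

lemma measurable_seed_init (n : ℕ) :
    Measurable fun p : π.Seed × History K (n + 1) => (p.1, (Fin.init p.2 : History K n)) :=
  measurable_fst.prodMk ((measurable_init n).comp measurable_snd)

lemma measurable_logLikelihood (hb : ∀ t, Measurable (b t)) (hb' : ∀ t, Measurable (b' t)) (V : ℝ)
    (n : ℕ) : Measurable (logLikelihood b b' V n) := by
  induction n with
  | zero => exact measurable_const
  | succ n ih =>
    have h := measurable_seed_init (π := π) n
    have hy : Measurable fun p : π.Seed × History K (n + 1) => (p.2 (Fin.last n)).2 :=
      measurable_snd.comp ((measurable_pi_apply _).comp measurable_snd)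
    exact (ih.comp h).add ((((hy.sub ((hb n).comp h)).pow_const 2).sub
      ((hy.sub ((hb' n).comp h)).pow_const 2)).div_const _)

/-- Change of measure: the law of the history under `b'` has density `exp (logLikelihood b b')`
with respect to its law under `b`. -/
lemma lintegral_adaptiveHistory_change {σ : ℝ≥0} (hσ : 0 < σ) (hb : ∀ t, Measurable (b t))
    (hb' : ∀ t, Measurable (b' t)) (n : ℕ) {F : π.Seed × History K n → ℝ≥0∞}
    (hF : Measurable F) :
    ∫⁻ ω, F (ω.1, π.adaptiveHistory b' ω n) ∂(π.prob σ) =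
      ∫⁻ ω, F (ω.1, π.adaptiveHistory b ω n) * ENNReal.ofReal
        (Real.exp (logLikelihood b b' (σ ^ 2 : ℝ≥0) n (ω.1, π.adaptiveHistory b ω n)))
        ∂(π.prob σ) := by
  have hV : σ ^ 2 ≠ 0 := (pow_pos hσ 2).ne'
  induction n with
  | zero => simp [logLikelihood, adaptiveHistory]
  | succ n ih =>
    have hG (c : π.AdaptiveMean) (hc : ∀ t, Measurable (c t)) :
        Measurable fun q : (π.Seed × History K n) × ℝ =>
          F (q.1.1, Fin.snoc (α := fun _ => Fin K × ℝ) q.1.2 (π.sample n q.1, c n q.1 + q.2)) :=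
      hF.comp ((measurable_fst.comp measurable_fst).prodMk (measurable_snoc
        (measurable_snd.comp measurable_fst) (((π.measurable_sample n).comp measurable_fst).prodMk
          (((hc n).comp measurable_fst).add measurable_snd))))
    rw [lintegral_adaptiveHistory_succ σ hb' n hF]
    -- The induction hypothesis is applied to `F` averaged over the last reward; shifting that
    -- Gaussian from `b'` to `b` then yields the factor of the last round.
    rw [ih (F := fun p => ∫⁻ x, F (p.1, Fin.snoc (α := fun _ => Fin K × ℝ) p.2
      (π.sample n p, b' n p + x)) ∂(gaussianReal 0 (σ ^ 2))) (hG b' hb').lintegral_prod_right']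
    rw [lintegral_adaptiveHistory_succ σ hb n (F := fun p => F p * ENNReal.ofReal
      (Real.exp (logLikelihood b b' (σ ^ 2 : ℝ≥0) (n + 1) p)))
      (hF.mul (measurable_logLikelihood hb hb' _ _).exp.ennreal_ofReal)]
    refine lintegral_congr fun ω => ?_
    set p : π.Seed × History K n := (ω.1, π.adaptiveHistory b ω n) with hp
    have hf : Measurable fun y : ℝ =>
        F (p.1, Fin.snoc (α := fun _ => Fin K × ℝ) p.2 (π.sample n p, y)) :=
      hF.comp (measurable_const.prodMk (measurable_snoc measurable_const
        (measurable_const.prodMk measurable_id)))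
    rw [lintegral_gaussianReal_const_add (b n p) (b' n p) hV hf,
      ← lintegral_mul_const _ (by fun_prop)]
    refine lintegral_congr fun x => ?_
    simp only [logLikelihood, Fin.init_snoc, Fin.snoc_last]
    rw [mul_assoc, ← ENNReal.ofReal_mul (Real.exp_nonneg _), ← Real.exp_add, add_comm (logLikelihood _ _ _ _ _)]

/-! ### The expected log-likelihood ratio -/

lemma logLikelihood_adaptiveHistory (V : ℝ) (n : ℕ) (ω : π.Outcome) :
    logLikelihood b b' V n (ω.1, π.adaptiveHistory b ω n) =
      ∑ t ∈ Finset.range n,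
        (-(b t (ω.1, π.adaptiveHistory b ω t) - b' t (ω.1, π.adaptiveHistory b ω t)) ^ 2 / (2 * V) -
          (b t (ω.1, π.adaptiveHistory b ω t) - b' t (ω.1, π.adaptiveHistory b ω t)) / V *
            ω.2 t) := by
  induction n with
  | zero => simp [logLikelihood]
  | succ n ih =>
    rw [Finset.sum_range_succ, ← ih]
    simp only [logLikelihood, adaptiveHistory, Fin.init_snoc, Fin.snoc_last]
    rw [add_right_inj]
    by_cases hV : V = 0
    · simp [hV]
    · field_simp
      ring

/-- After resampling, the factor `c` no longer sees the noise of round `n`, so the integral factors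
and the centred noise gives zero. -/
lemma integral_predictable_mul_noise (σ : ℝ≥0) (hb : ∀ t, Measurable (b t)) (n : ℕ)
    {c : π.Seed × History K n → ℝ} (hc : Measurable c) {C : ℝ} (hC : ∀ p, |c p| ≤ C) :
    Integrable (fun ω : π.Outcome => c (ω.1, π.adaptiveHistory b ω n) * ω.2 n) (π.prob σ) ∧
      ∫ ω, c (ω.1, π.adaptiveHistory b ω n) * ω.2 n ∂(π.prob σ) = 0 := by
  have hmp := measurePreserving_resample_prob π σ n
  have hcm : Measurable fun ω : π.Outcome => c (ω.1, π.adaptiveHistory b ω n) :=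
    hc.comp (measurable_seed_history hb n)
  have hm : Measurable fun ω : π.Outcome => c (ω.1, π.adaptiveHistory b ω n) * ω.2 n :=
    hcm.mul ((measurable_pi_apply n).comp measurable_snd)
  have hci : Integrable (fun ω : π.Outcome => c (ω.1, π.adaptiveHistory b ω n)) (π.prob σ) :=
    Integrable.of_bound hcm.aestronglyMeasurable C (ae_of_all _ fun ω => hC _)
  have hcomp : (fun ω : π.Outcome => c (ω.1, π.adaptiveHistory b ω n) * ω.2 n) ∘
      (fun p : π.Outcome × ℝ => (p.1.1, Function.update p.1.2 n p.2)) =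
      fun p => c (p.1.1, π.adaptiveHistory b p.1 n) * p.2 := by
    funext p
    simp [adaptiveHistory_update _ _ n _ le_rfl]
  constructor
  · rw [← hmp.integrable_comp hm.aestronglyMeasurable, hcomp]
    exact hci.mul_prod (integrable_id_gaussianReal 0 _)
  · have h0 := integral_map (μ := (π.prob σ).prod (gaussianReal 0 (σ ^ 2)))
      hmp.measurable.aemeasurable (f := fun ω : π.Outcome =>
        c (ω.1, π.adaptiveHistory b ω n) * ω.2 n) hm.aestronglyMeasurable
    rw [hmp.map_eq] at h0
    rw [h0]
    have h := integral_prod_mul (μ := π.prob σ) (ν := gaussianReal 0 (σ ^ 2))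
      (fun ω : π.Outcome => c (ω.1, π.adaptiveHistory b ω n)) (fun x : ℝ => x)
    rw [integral_id_gaussianReal, mul_zero] at h
    exact (integral_congr_ae (ae_of_all _ fun p => congrFun hcomp p)).trans h

lemma integral_logLikelihood (σ : ℝ≥0) (hb : ∀ t, Measurable (b t))
    (hb' : ∀ t, Measurable (b' t)) {C : ℝ} (hC : ∀ t p, |b t p - b' t p| ≤ C) (V : ℝ) (n : ℕ) :
    Integrable (fun ω : π.Outcome => logLikelihood b b' V n (ω.1, π.adaptiveHistory b ω n))
      (π.prob σ) ∧
    ∫ ω, logLikelihood b b' V n (ω.1, π.adaptiveHistory b ω n) ∂(π.prob σ) =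
      -∑ t ∈ Finset.range n, (∫ ω, (b t (ω.1, π.adaptiveHistory b ω t) -
        b' t (ω.1, π.adaptiveHistory b ω t)) ^ 2 ∂(π.prob σ)) / (2 * V) := by
  have h1 (t : ℕ) := integral_predictable_mul_noise σ hb t (c := fun p => (b t p - b' t p) / V)
    (((hb t).sub (hb' t)).div_const V) (C := C / |V|) fun p => by
      rw [abs_div]
      exact div_le_div_of_nonneg_right (hC t p) (abs_nonneg V)
  have h2 (t : ℕ) : Integrable (fun ω : π.Outcome => -(b t (ω.1, π.adaptiveHistory b ω t) -
      b' t (ω.1, π.adaptiveHistory b ω t)) ^ 2 / (2 * V)) (π.prob σ) := by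
    refine (Integrable.of_bound (C := C ^ 2) ?_ (ae_of_all _ fun ω => ?_)).neg.div_const _
    · exact ((((hb t).sub (hb' t)).comp (measurable_seed_history hb t)).pow_const
        2).aestronglyMeasurable
    · rw [norm_pow, Real.norm_eq_abs]
      exact pow_le_pow_left₀ (abs_nonneg _) (hC t _) 2
  simp_rw [logLikelihood_adaptiveHistory]
  have h3 (t : ℕ) : Integrable (fun ω : π.Outcome => -(b t (ω.1, π.adaptiveHistory b ω t) -
      b' t (ω.1, π.adaptiveHistory b ω t)) ^ 2 / (2 * V) - (b t (ω.1, π.adaptiveHistory b ω t) -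
      b' t (ω.1, π.adaptiveHistory b ω t)) / V * ω.2 t) (π.prob σ) := (h2 t).sub (h1 t).1
  refine ⟨integrable_finsetSum _ fun t _ => h3 t, ?_⟩
  rw [integral_finsetSum _ fun t _ => h3 t, ← Finset.sum_neg_distrib]
  refine Finset.sum_congr rfl fun t _ => ?_
  rw [integral_sub (h2 t) (h1 t).1, (h1 t).2, sub_zero, integral_div, integral_neg, neg_div]

end Policy

end ChangePointBandit

namespace ChangePointBandit

/-! ### Stopping -/

namespace Policy

variable {K N : ℕ} (π : Policy K N)

/-- The histories of length `n` along which the policy has asked to halt. -/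
def haltedBy : (n : ℕ) → Set (π.Seed × History K n)
  | 0 => π.halt 0
  | n + 1 => {p | (p.1, Fin.init p.2) ∈ haltedBy n ∨ p ∈ π.halt (n + 1)}

/-- The histories of length `n` along which the policy has halted and returned an element of `R`. -/
def returnedBy (R : Set (Finset (Fin (K - 1)))) : (n : ℕ) → Set (π.Seed × History K n)
  | 0 => {p | p ∈ π.halt 0 ∧ π.recommend 0 p ∈ R}
  | n + 1 => {p | (p.1, Fin.init p.2) ∈ returnedBy R n ∨
      ((p.1, Fin.init p.2) ∉ π.haltedBy n ∧ p ∈ π.halt (n + 1) ∧ π.recommend (n + 1) p ∈ R)}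

lemma measurableSet_haltedBy (n : ℕ) : MeasurableSet (π.haltedBy n) := by
  induction n with
  | zero => exact π.measurableSet_halt 0
  | succ n ih => exact (measurable_seed_init n ih).union (π.measurableSet_halt (n + 1))

lemma measurableSet_recommend_mem (R : Set (Finset (Fin (K - 1)))) (n : ℕ) :
    MeasurableSet {p | π.recommend n p ∈ R} := by
  have : {p | π.recommend n p ∈ R} = ⋃ S ∈ R, π.recommend n ⁻¹' {S} := by ext; simp
  rw [this]
  exact MeasurableSet.biUnion R.toFinite.countable fun S _ => π.measurableSet_recommend n S

lemma measurableSet_returnedBy (R : Set (Finset (Fin (K - 1)))) (n : ℕ) :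
    MeasurableSet (π.returnedBy R n) := by
  induction n with
  | zero => exact (π.measurableSet_halt 0).inter (π.measurableSet_recommend_mem R 0)
  | succ n ih =>
    exact (measurable_seed_init n ih).union ((measurable_seed_init n
      (π.measurableSet_haltedBy n)).compl.inter ((π.measurableSet_halt (n + 1)).inter
        (π.measurableSet_recommend_mem R (n + 1))))

lemma init_history_succ (v : Fin K → ℝ) (ω : π.Outcome) (n : ℕ) :
    (Fin.init (π.history v ω (n + 1)) : History K n) = π.history v ω n :=
  Fin.init_snoc _ _

lemma stoppingTime_le_iff (v : Fin K → ℝ) (ω : π.Outcome) (n : ℕ) :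
    π.stoppingTime v ω ≤ n ↔ ∃ t ≤ n, π.StopsAt v ω t := by
  constructor
  · intro h
    by_contra! hn
    have : ((n + 1 : ℕ) : ℕ∞) ≤ π.stoppingTime v ω := by
      refine le_iInf₂ fun t ht => ?_
      have : ¬ t ≤ n := fun hle => hn t hle ht
      exact_mod_cast (by omega : n + 1 ≤ t)
    have := this.trans h
    have : n + 1 ≤ n := by exact_mod_cast this
    omega
  · rintro ⟨t, ht, hs⟩
    exact (iInf₂_le t hs).trans (by exact_mod_cast ht)

lemma mem_haltedBy_history (v : Fin K → ℝ) (ω : π.Outcome) (n : ℕ) :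
    (ω.1, π.history v ω n) ∈ π.haltedBy n ↔ π.stoppingTime v ω ≤ n := by
  rw [stoppingTime_le_iff]
  induction n with
  | zero => simp [haltedBy, StopsAt]
  | succ n ih =>
    simp only [haltedBy, Set.mem_ofPred_eq, init_history_succ, ih]
    constructor
    · rintro (⟨t, ht, hs⟩ | h)
      exacts [⟨t, by omega, hs⟩, ⟨n + 1, le_rfl, h⟩]
    · rintro ⟨t, ht, hs⟩
      rcases Nat.le_succ_iff.1 ht with h | rfl
      exacts [Or.inl ⟨t, h, hs⟩, Or.inr hs]

lemma stoppingTime_eq_succ_iff (v : Fin K → ℝ) (ω : π.Outcome) (n : ℕ) :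
    π.stoppingTime v ω = (n + 1 : ℕ) ↔ ¬ π.stoppingTime v ω ≤ n ∧ π.StopsAt v ω (n + 1) := by
  constructor
  · intro h
    have hle : ¬ π.stoppingTime v ω ≤ n := by
      rw [h]
      exact_mod_cast (by omega : ¬ n + 1 ≤ n)
    obtain ⟨t, ht, hs⟩ := (π.stoppingTime_le_iff v ω (n + 1)).1 h.le
    rcases Nat.le_succ_iff.1 ht with h' | rfl
    · exact absurd ((π.stoppingTime_le_iff v ω n).2 ⟨t, h', hs⟩) hle
    · exact ⟨hle, hs⟩
  · rintro ⟨h, hs⟩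
    refine le_antisymm ((π.stoppingTime_le_iff v ω (n + 1)).2 ⟨_, le_rfl, hs⟩) ?_
    push_cast
    exact Order.add_one_le_of_lt (not_le.1 h)

lemma mem_returnedBy_history (R : Set (Finset (Fin (K - 1)))) (v : Fin K → ℝ) (ω : π.Outcome)
    (n : ℕ) : (ω.1, π.history v ω n) ∈ π.returnedBy R n ↔
      ∃ t ≤ n, π.stoppingTime v ω = (t : ℕ∞) ∧ π.recommend t (ω.1, π.history v ω t) ∈ R := by
  induction n with
  | zero =>
    have h := π.stoppingTime_le_iff v ω 0
    simp only [CharP.cast_eq_zero, nonpos_iff_eq_zero, exists_eq_left] at h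
    simp only [returnedBy, Set.mem_ofPred_eq, nonpos_iff_eq_zero, exists_eq_left, CharP.cast_eq_zero,
      h]
    rfl
  | succ n ih =>
    simp only [returnedBy, Set.mem_ofPred_eq, init_history_succ, ih, mem_haltedBy_history]
    constructor
    · rintro (⟨t, ht, hs⟩ | ⟨h1, h2, h3⟩)
      · exact ⟨t, by omega, hs⟩
      · exact ⟨n + 1, le_rfl, (π.stoppingTime_eq_succ_iff v ω n).2 ⟨h1, h2⟩, h3⟩
    · rintro ⟨t, ht, hs, hR⟩
      rcases Nat.le_succ_iff.1 ht with h | rfl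
      · exact Or.inl ⟨t, h, hs, hR⟩
      · have := (π.stoppingTime_eq_succ_iff v ω n).1 hs
        exact Or.inr ⟨this.1, this.2, hR⟩

open scoped Classical in
/-- The mean rewards of `w` until the policy halts, and those of `v` afterwards. -/
noncomputable def switchMean (v w : Fin K → ℝ) : π.AdaptiveMean := fun t p =>
  if p ∈ π.haltedBy t then v (π.sample t p) else w (π.sample t p)

lemma measurable_switchMean (v w : Fin K → ℝ) (t : ℕ) : Measurable (π.switchMean v w t) :=
  Measurable.ite (π.measurableSet_haltedBy t) (π.measurable_envMean v t)
    (π.measurable_envMean w t)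

/-- Both histories coincide until the policy halts, and after that membership is frozen. The
induction has to carry all three facts together. -/
lemma mem_returnedBy_switchMean (R : Set (Finset (Fin (K - 1)))) (v w : Fin K → ℝ)
    (ω : π.Outcome) (n : ℕ) :
    (ω.1, π.adaptiveHistory (π.switchMean v w) ω n) ∈ π.returnedBy R n ↔
      (ω.1, π.history w ω n) ∈ π.returnedBy R n := by
  suffices h : ((ω.1, π.adaptiveHistory (π.switchMean v w) ω n) ∈ π.haltedBy n ↔
      (ω.1, π.history w ω n) ∈ π.haltedBy n) ∧
      ((ω.1, π.adaptiveHistory (π.switchMean v w) ω n) ∈ π.returnedBy R n ↔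
        (ω.1, π.history w ω n) ∈ π.returnedBy R n) ∧
      ((ω.1, π.history w ω n) ∉ π.haltedBy n →
        π.adaptiveHistory (π.switchMean v w) ω n = π.history w ω n) from h.2.1
  induction n with
  | zero => exact ⟨Iff.rfl, Iff.rfl, fun _ => rfl⟩
  | succ n ih =>
    have hinit : (Fin.init (π.adaptiveHistory (π.switchMean v w) ω (n + 1)) : History K n) =
        π.adaptiveHistory (π.switchMean v w) ω n := Fin.init_snoc _ _
    by_cases h : (ω.1, π.history w ω n) ∈ π.haltedBy n
    · simp only [haltedBy, returnedBy, Set.mem_ofPred_eq, hinit, init_history_succ, ih.1, ih.2.1, h,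
        true_or, not_true_eq_false, false_and, or_false, false_implies, and_self]
    · have heq : π.adaptiveHistory (π.switchMean v w) ω (n + 1) = π.history w ω (n + 1) := by
        simp only [adaptiveHistory, history, ih.2.2 h, switchMean, h, if_false]
      rw [heq]
      exact ⟨Iff.rfl, Iff.rfl, fun _ => rfl⟩

/-! ### The lower bound on the expected stopping time -/

/-- The event that in environment `v` the policy does not stop within `t` rounds and plays one of
the two arms next to `j` in the following round. -/
def playsNextTo (v : Fin K → ℝ) (j : Fin (K - 1)) (t : ℕ) : Set π.Outcome :=
  {ω | (ω.1, π.history v ω t) ∉ π.haltedBy t ∧ IsNextTo j (π.sample t (ω.1, π.history v ω t))}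

lemma measurable_seed_envHistory (v : Fin K → ℝ) (t : ℕ) :
    Measurable fun ω : π.Outcome => (ω.1, π.history v ω t) := by
  have h := measurable_seed_history (π.measurable_envMean v) t
  simpa only [adaptiveHistory_envMean] using h

lemma measurableSet_playsNextTo (v : Fin K → ℝ) (j : Fin (K - 1)) (t : ℕ) :
    MeasurableSet (π.playsNextTo v j t) :=
  (π.measurable_seed_envHistory v t (π.measurableSet_haltedBy t)).compl.inter
    (((π.measurable_sample t).comp (π.measurable_seed_envHistory v t))
      (MeasurableSet.of_discrete (s := {i | IsNextTo j i})))

lemma correct_eq_iUnion (v : Fin K → ℝ) : π.correct v =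
      ⋃ n, {ω | (ω.1, π.history v ω n) ∈ π.returnedBy {S | S ⊆ changePoints v} n} := by
  ext ω
  simp only [correct, Set.mem_ofPred_eq, Set.mem_iUnion, mem_returnedBy_history]
  constructor
  · rintro ⟨t, ht⟩
    exact ⟨t, t, le_rfl, ht⟩
  · rintro ⟨_, t, _, ht⟩
    exact ⟨t, ht⟩

/-- Continuity from below yields a finite horizon, so the change of measure involves only finitely
many rounds. -/
lemma exists_lt_prob_returnedBy (σ : ℝ≥0) (w : Fin K → ℝ) {r : ℝ≥0∞}
    (h : r < π.prob σ (π.correct w)) :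
    ∃ n, r < π.prob σ
      {ω | (ω.1, π.history w ω n) ∈ π.returnedBy {S | S ⊆ changePoints w} n} := by
  rw [correct_eq_iUnion, Monotone.measure_iUnion] at h
  · exact lt_iSup_iff.1 h
  · intro m n hmn ω hω
    simp only [Set.mem_ofPred_eq, mem_returnedBy_history] at hω ⊢
    obtain ⟨t, ht, h⟩ := hω
    exact ⟨t, ht.trans hmn, h⟩

lemma measurableSet_correct (v : Fin K → ℝ) : MeasurableSet (π.correct v) := by
  rw [correct_eq_iUnion]
  exact MeasurableSet.iUnion fun n =>
    π.measurable_seed_envHistory v n (π.measurableSet_returnedBy _ n)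

end Policy

/-- Pathwise tail-sum formula, valid also for `τ = ⊤`; integrated, it writes the expected stopping
time as a sum of tail probabilities. -/
lemma tsum_indicator_lt (τ : ℕ∞) :
    ∑' t : ℕ, {t : ℕ | (t : ℕ∞) < τ}.indicator (fun _ => (1 : ℝ≥0∞)) t = τ := by
  rw [← tsum_subtype {t : ℕ | (t : ℕ∞) < τ} fun _ => (1 : ℝ≥0∞), ENNReal.tsum_set_one]
  congr 1
  induction τ using ENat.recTopCoe with
  | top =>
    have : {t : ℕ | (t : ℕ∞) < ⊤} = Set.univ := Set.eq_univ_of_forall ENat.natCast_lt_top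
    rw [this]
    simp
  | coe n =>
    have : {t : ℕ | (t : ℕ∞) < n} = (Finset.range n : Set ℕ) := by ext; simp
    rw [this, Set.encard_coe_eq_coe_finsetCard, Finset.card_range]

end ChangePointBandit

namespace ChangePointBandit

lemma prob_compl_lt_ofReal {Ω : Type*} [MeasurableSpace Ω] {P : Measure Ω} [IsProbabilityMeasure P]
    {B : Set Ω} (hB : MeasurableSet B) {δ : ℝ} (hδ : δ < 1) (h : ENNReal.ofReal (1 - δ) < P B) :
    P Bᶜ < ENNReal.ofReal δ := by
  rw [ENNReal.ofReal_lt_iff_lt_toReal (by linarith) (measure_ne_top _ _)] at h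
  rw [ENNReal.lt_ofReal_iff_toReal_lt (measure_ne_top _ _)]
  change P.real Bᶜ < δ
  change 1 - δ < P.real B at h
  rw [probReal_compl_eq_one_sub hB]
  linarith

namespace Policy

variable {K N : ℕ} (π : Policy K N)

/-- If no estimate is correct in both `v` and `w`, then a policy that is correct with high
probability in both has to collect information in `v` about the difference. -/
lemma log_lt_information {σ : ℝ≥0} (hσ : 0 < σ) {δ : ℝ} (hδ : 0 < δ) (hδ1 : δ < 1)
    {v w : Fin K → ℝ} (hv : ENNReal.ofReal (1 - δ) < π.prob σ (π.correct v))
    (hw : ENNReal.ofReal (1 - δ) < π.prob σ (π.correct w))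
    (hvw : ∀ S : Finset (Fin (K - 1)), S.card = N → S ⊆ changePoints v → ¬ S ⊆ changePoints w) :
    ∃ n, Real.log (1 / (4 * δ)) < ∑ t ∈ Finset.range n,
      (∫ ω, ({ω : π.Outcome | (ω.1, π.history v ω t) ∉ π.haltedBy t}.indicator
        (fun ω => (v (π.sample t (ω.1, π.history v ω t)) -
          w (π.sample t (ω.1, π.history v ω t))) ^ 2) ω) ∂(π.prob σ)) / (2 * (σ : ℝ) ^ 2) := by
  obtain ⟨n, hn⟩ := π.exists_lt_prob_returnedBy σ w hw
  refine ⟨n, ?_⟩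
  set R : Set (Finset (Fin (K - 1))) := {S | S ⊆ changePoints w} with hR
  set B := π.returnedBy R n with hB
  have hBm : MeasurableSet B := π.measurableSet_returnedBy R n
  have hb := π.measurable_envMean v
  have hb' := π.measurable_switchMean v w
  have hdiff (t : ℕ) (p : π.Seed × History K t) :
      (p ∈ π.haltedBy t → π.envMean v t p - π.switchMean v w t p = 0) ∧
      (p ∉ π.haltedBy t → π.envMean v t p - π.switchMean v w t p =
        v (π.sample t p) - w (π.sample t p)) := by
    constructor <;> intro h <;> simp [envMean, switchMean, h]
  have hC (t : ℕ) (p : π.Seed × History K t) :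
      |π.envMean v t p - π.switchMean v w t p| ≤ ∑ i, |v i - w i| := by
    by_cases h : p ∈ π.haltedBy t
    · rw [(hdiff t p).1 h, abs_zero]
      exact Finset.sum_nonneg fun i _ => abs_nonneg _
    · rw [(hdiff t p).2 h]
      exact Finset.single_le_sum (f := fun i => |v i - w i|) (fun i _ => abs_nonneg _)
        (Finset.mem_univ _)
  obtain ⟨hXi, hXe⟩ := integral_logLikelihood σ hb hb' hC (σ ^ 2 : ℝ≥0) n
  have hexp := lintegral_adaptiveHistory_change hσ hb hb' n (F := fun _ => 1) measurable_const
  simp only [lintegral_const, measure_univ, one_mul] at hexp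
  have hch := lintegral_adaptiveHistory_change hσ hb hb' n
    (F := Bᶜ.indicator fun _ => 1) (measurable_const.indicator hBm.compl)
  set X : π.Outcome → ℝ := fun ω => logLikelihood (π.envMean v) (π.switchMean v w)
    (σ ^ 2 : ℝ≥0) n (ω.1, π.adaptiveHistory (π.envMean v) ω n) with hX
  have hXm : Measurable X :=
    (measurable_logLikelihood hb hb' _ n).comp (measurable_seed_history hb n)
  set A : Set π.Outcome := {ω | (ω.1, π.history v ω n) ∈ B} with hA
  have hAm : MeasurableSet A := π.measurable_seed_envHistory v n hBm
  have hA' : MeasurableSet {ω : π.Outcome | (ω.1, π.history w ω n) ∈ B} :=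
    π.measurable_seed_envHistory w n hBm
  -- Both errors are below `δ`: under `w` the event `Aᶜ` means no correct return by time `n`, and
  -- under `v` the event `A` means a return that is correct for `w`, hence wrong for `v`.
  have hbh := bretagnolle_huber hXm hXi hexp.symm hAm.compl
  have hI : ∫⁻ ω in Aᶜ, ENNReal.ofReal (Real.exp (X ω)) ∂(π.prob σ) =
      π.prob σ {ω : π.Outcome | (ω.1, π.history w ω n) ∈ B}ᶜ := by
    rw [← lintegral_indicator hAm.compl, ← lintegral_indicator_one hA'.compl]
    refine Eq.trans ?_ (hch.symm.trans ?_)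
    · refine lintegral_congr fun ω => ?_
      by_cases h : (ω.1, π.history v ω n) ∈ B <;>
        simp [Set.indicator, hA, h, adaptiveHistory_envMean, hX]
    · refine lintegral_congr fun ω => ?_
      have := π.mem_returnedBy_switchMean R v w ω n
      rw [← hB] at this
      by_cases h : (ω.1, π.history w ω n) ∈ B
      · simp [Set.indicator, this.2 h, h]
      · simp [Set.indicator, mt this.1 h, h]
  have hAv : A ⊆ (π.correct v)ᶜ := by
    intro ω hω hc
    obtain ⟨t, -, ht, hr⟩ := (π.mem_returnedBy_history R v ω n).1 hω
    obtain ⟨t', ht', hr'⟩ := hc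
    have : t' = t := by
      rw [ht] at ht'
      exact_mod_cast ht'.symm
    subst this
    exact hvw _ (π.card_recommend _ _) hr' hr
  have h1 := prob_compl_lt_ofReal hA' hδ1 hn
  have h2 := (measure_mono hAv).trans_lt
    (prob_compl_lt_ofReal (π.measurableSet_correct v) hδ1 hv)
  rw [hI, compl_compl] at hbh
  have h3 := hbh.trans_lt (ENNReal.add_lt_add h1 h2)
  rw [← ENNReal.ofReal_add hδ.le hδ.le, ENNReal.ofReal_lt_ofReal_iff (by positivity)] at h3
  have h4 : ∫ ω, X ω ∂(π.prob σ) < Real.log (4 * δ) := by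
    rw [Real.lt_log_iff_exp_lt (by positivity)]
    linarith
  rw [hXe] at h4
  rw [one_div, Real.log_inv]
  refine lt_of_lt_of_eq (neg_lt.1 h4) ?_
  refine Finset.sum_congr rfl fun t _ => ?_
  congr 1
  · refine integral_congr_ae (ae_of_all _ fun ω => ?_)
    simp only [adaptiveHistory_envMean]
    by_cases h : (ω.1, π.history v ω t) ∈ π.haltedBy t
    · simp [(hdiff t _).1 h, h]
    · simp [(hdiff t _).2 h, h]

lemma le_tsum_prob_playsNextTo {g : ℕ} (hK : 3 ≤ K) (hg : g = 1 ∨ g = 2) {σ : ℝ≥0} (hσ : 0 < σ)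
    {v : Fin K → ℝ} (hv : v ∈ env (g + 1) K N) {δ : ℝ} (hδ : 0 < δ) (hδ1 : δ < 1)
    (hπ : π.IsAny g σ δ) {j : Fin (K - 1)} (hj : j ∈ changePoints v) :
    ENNReal.ofReal (8 * (σ : ℝ) ^ 2 * Real.log (1 / (4 * δ)) * (1 / jump v j ^ 2)) ≤
      ∑' t, π.prob σ (π.playsNextTo v j t) := by
  have hσ' : (0 : ℝ) < σ := hσ
  have hJ := jump_pos hj
  have hm := midpoint_ne (mem_changePoints.1 hj)
  -- At the midpoint both arms are off by `Δ / 2`, so only the total number of pulls of the pair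
  -- matters.
  set w := mergeAt v j ((v (leftArm j) + v (rightArm j)) / 2) with hw
  obtain ⟨m, hNm, hwm⟩ := mergeAt_mem_env hK hg hv hj hm.1 hm.2
  have hvg : v ∈ env g K N := ⟨hv.1, fun a ha b hb hab => by have := hv.2 a ha b hb hab; omega⟩
  -- A set of `N` true change points of `v` is all of them, hence contains `j`.
  obtain ⟨n, hn⟩ := π.log_lt_information hσ hδ hδ1 (hπ N le_rfl v hvg).1 (hπ m hNm w hwm).1
    fun S hS hSv hSw => notMem_changePoints_mergeAt v j _ <| hSw <| by
      rwa [Finset.eq_of_subset_of_card_le hSv (by rw [hv.1, hS])]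
  have hint (t : ℕ) : ∫ ω, ({ω : π.Outcome | (ω.1, π.history v ω t) ∉ π.haltedBy t}.indicator
      (fun ω => (v (π.sample t (ω.1, π.history v ω t)) -
        w (π.sample t (ω.1, π.history v ω t))) ^ 2) ω) ∂(π.prob σ) =
      (π.prob σ).real (π.playsNextTo v j t) * (jump v j ^ 2 / 4) := by
    rw [← smul_eq_mul, ← integral_indicator_const _ (π.measurableSet_playsNextTo v j t)]
    refine integral_congr_ae (ae_of_all _ fun ω => ?_)
    by_cases h : (ω.1, π.history v ω t) ∈ π.haltedBy t
    · simp [h, playsNextTo]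
    by_cases h' : IsNextTo j (π.sample t (ω.1, π.history v ω t))
    · have e : (v (π.sample t (ω.1, π.history v ω t)) -
          (v (leftArm j) + v (rightArm j)) / 2) ^ 2 = jump v j ^ 2 / 4 := by
        rw [jump_sq]
        rcases h' with h' | h' <;> rw [h'] <;> ring
      simp [h, h', playsNextTo, hw, mergeAt, e]
    · simp [h, h', playsNextTo, hw, mergeAt]
  simp_rw [hint] at hn
  rw [← Finset.sum_div, ← Finset.sum_mul, lt_div_iff₀ (by positivity)] at hn
  refine le_trans ?_ (ENNReal.sum_le_tsum (Finset.range n))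
  rw [ENNReal.ofReal_le_iff_le_toReal (ENNReal.sum_ne_top.2 fun t _ => measure_ne_top _ _),
    ENNReal.toReal_sum fun t _ => measure_ne_top _ _]
  change _ ≤ ∑ t ∈ Finset.range n, (π.prob σ).real (π.playsNextTo v j t)
  rw [mul_one_div, div_le_iff₀ (by positivity)]
  linarith

lemma sum_tsum_prob_playsNextTo_le {g : ℕ} (hg : 1 ≤ g) (σ : ℝ≥0) {v : Fin K → ℝ}
    (hv : v ∈ env (g + 1) K N) :
    ∑ j ∈ changePoints v, ∑' t, π.prob σ (π.playsNextTo v j t) ≤ π.expectedStoppingTime σ v := by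
  have hm (t : ℕ) : MeasurableSet {ω : π.Outcome | (t : ℕ∞) < π.stoppingTime v ω} := by
    have : {ω : π.Outcome | (t : ℕ∞) < π.stoppingTime v ω} =
        {ω | (ω.1, π.history v ω t) ∈ π.haltedBy t}ᶜ := by
      ext ω
      simp [mem_haltedBy_history]
    rw [this]
    exact (π.measurable_seed_envHistory v t (π.measurableSet_haltedBy t)).compl
  have hE : π.expectedStoppingTime σ v =
      ∑' t : ℕ, π.prob σ {ω | (t : ℕ∞) < π.stoppingTime v ω} := by
    simp_rw [expectedStoppingTime, ← tsum_indicator_lt, ← lintegral_indicator_one (hm _)]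
    rw [← lintegral_tsum fun t => (measurable_one.indicator (hm t)).aemeasurable]
    rfl
  rw [hE, ← Summable.tsum_finsetSum fun _ _ => ENNReal.summable]
  refine ENNReal.tsum_le_tsum fun t => ?_
  rw [← measure_biUnion_finset _ fun j _ => π.measurableSet_playsNextTo v j t]
  · refine measure_mono (Set.iUnion₂_subset fun j _ ω hω => ?_)
    exact not_le.1 (mt (π.mem_haltedBy_history v ω t).2 hω.1)
  · intro j hj k hk hjk
    refine Set.disjoint_left.2 fun ω hω hω' => hjk ?_
    exact eq_of_isNextTo hg hv hj hk hω.2 hω'.2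

lemma le_expectedStoppingTime {g : ℕ} (hK : 3 ≤ K) (hg : g = 1 ∨ g = 2) {σ : ℝ≥0} (hσ : 0 < σ)
    {v : Fin K → ℝ} (hv : v ∈ env (g + 1) K N) {δ : ℝ} (hδ : 0 < δ) (hδ1 : δ < 1)
    (hπ : π.IsAny g σ δ) :
    ENNReal.ofReal (8 * (σ : ℝ) ^ 2 * Real.log (1 / (4 * δ)) * complexity v) ≤
      π.expectedStoppingTime σ v := by
  refine le_trans ?_ (π.sum_tsum_prob_playsNextTo_le (by omega) σ hv)
  refine le_trans ?_ (Finset.sum_le_sum fun j hj =>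
    π.le_tsum_prob_playsNextTo hK hg hσ hv hδ hδ1 hπ hj)
  rw [complexity, Finset.mul_sum]
  -- The logarithm is negative for `δ > 1 / 4`, so only subadditivity of `ENNReal.ofReal` is used.
  exact Finset.le_sum_of_subadditive _ ENNReal.ofReal_zero.le (fun _ _ => ENNReal.ofReal_add_le) _ _

end Policy

end ChangePointBandit

open ChangePointBandit
theorem mainTheorem7 (K N g : ℕ) (hK : 3 ≤ K) (hN : 1 ≤ N) (hg : g = 1 ∨ g = 2)
    (σ : ℝ≥0) (hσ : 0 < σ) (v : Fin K → ℝ) (hv : v ∈ env (g + 1) K N) :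
    (∀ δ : ℝ, 0 < δ → δ < 1 → ∀ π : Policy K N, π.IsAny g σ δ →
      ENNReal.ofReal (8 * (σ : ℝ) ^ 2 * Real.log (1 / (4 * δ)) * complexity v)
        ≤ π.expectedStoppingTime σ v) ∧
    ∃ α ∈ stdSimplex ℝ (Fin K),
      (∀ j ∈ changePoints v,
        α (leftArm j) = (1 / jump v j ^ 2) / (2 * complexity v) ∧
        α (rightArm j) = (1 / jump v j ^ 2) / (2 * complexity v)) ∧
      (∀ i, (∀ j ∈ changePoints v, i ≠ leftArm j ∧ i ≠ rightArm j) → α i = 0) ∧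
      infoRate g N σ v α = ENNReal.ofReal (1 / (8 * (σ : ℝ) ^ 2 * complexity v)) ∧
      ∀ β ∈ stdSimplex ℝ (Fin K), β ≠ α → infoRate g N σ v β < infoRate g N σ v α := by
  have hg1 : 1 ≤ g := by omega
  have hne : (changePoints v).Nonempty := Finset.card_pos.1 (by rw [hv.1]; omega)
  refine ⟨fun δ hδ hδ1 π hπ => π.le_expectedStoppingTime hK hg hσ hv hδ hδ1 hπ,
    optimalAllocation v, ⟨optimalAllocation_nonneg v, sum_optimalAllocation hne⟩,
    fun j hj => ⟨optimalAllocation_of_isNextTo hg1 hv hj (Or.inl rfl),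
      optimalAllocation_of_isNextTo hg1 hv hj (Or.inr rfl)⟩,
    fun i hi => optimalAllocation_eq_zero fun j hj h => h.elim (hi j hj).1 (hi j hj).2,
    infoRate_optimalAllocation hK hN hg hσ hv, fun β hβ hβα => ?_⟩
  rw [infoRate_optimalAllocation hK hN hg hσ hv]
  exact infoRate_lt hK hN hg hσ hv hβ hβα
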